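/- **Corollary 3 (Thue–Morse prefix normal forms).** An infinite binary word is a sequence $w = w_1w_2w_3\cdots$ with letters in $\{0,1\}$; it is called aperiodic if it is not of the form $vu^{\omega}$ with $v$ a (possibly empty) finite word and $u$ a non-empty finite word, where $u^{\omega} = uuu\cdots$. For $a\in\{0,1\}$ and $n \ge 0$, let $F^a_w(n)$ be the maximum number of occurrences of $a$ in a factor (contiguous block) of $w$ of length $n$. The prefix normal forms of $w$ are the infinite binary words $\mathrm{PNF}_1(w)$ and $\mathrm{PNF}_0(w)$ whose $n$-th letters ($n\ge 1$) are $F^1_w(n)-F^1_w(n-1)$ and $1-\bigl(F^0_w(n)-F^0_w(n-1)\bigr)$, respectively. Let $\mu_{\mathrm{TM}}$ be the Thue–Morse morphism, which replaces each letter $0$ of a word by $01$ and each letter $1$ by $10$. Let $w$ be an aperiodic infinite binary word. Then $\mathrm{PNF}_1(w) = 1(10)^{\omega}$ and $\mathrm{PNF}_0(w) = 0(01)^{\omega}$ if and only if $w = \mu_{\mathrm{TM}}(w')$, $w = 0\,\mu_{\mathrm{TM}}(w')$ or $w = 1\,\mu_{\mathrm{TM}}(w')$ for some infinite binary word $w'$.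 -/

import Mathlib

/-- Binary letters: `true` is the letter `1` and `false` is the letter `0`.
An infinite binary word `w₁w₂w₃⋯` is the stream whose entry of index `i` is `w_{i+1}`. -/
abbrev InfWord : Type := Stream' Bool

/-- `x` is a factor of `w`: `w = u x v` for a finite word `u` and an infinite word `v`. -/
def IsFactor (x : List Bool) (w : InfWord) : Prop :=
  ∃ (u : List Bool) (v : InfWord), w = u ++ₛ (x ++ₛ v)

/-- `w = u^ω` for some non-empty finite word `u`. -/
def IsPeriodicWord (w : InfWord) : Prop :=
  ∃ (u : List Bool) (hu : u ≠ []), w = Stream'.cycle u hu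

/-- `w = v u^ω` for some finite word `v` and some non-empty finite word `u`. -/
def IsUltimatelyPeriodicWord (w : InfWord) : Prop :=
  ∃ (v u : List Bool) (hu : u ≠ []), w = v ++ₛ Stream'.cycle u hu

/-- `w` is neither periodic nor ultimately periodic. -/
def IsAperiodicWord (w : InfWord) : Prop :=
  ¬ IsPeriodicWord w ∧ ¬ IsUltimatelyPeriodicWord w

/-- The numbers of occurrences of the letter `a` in the factors of length `n` of `w`. -/
def factorCounts (a : Bool) (w : InfWord) (n : ℕ) : Set ℕ :=
  {k | ∃ u : List Bool, IsFactor u w ∧ u.length = n ∧ u.count a = k}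

/-- `F^a_w(n)`, the maximum number of occurrences of `a` in a factor of length `n` of `w`
(a true maximum, by `isGreatest_maxCount`). -/
noncomputable def maxCount (a : Bool) (w : InfWord) (n : ℕ) : ℕ :=
  sSup (factorCounts a w n)

theorem isGreatest_maxCount (a : Bool) (w : InfWord) (n : ℕ) :
    IsGreatest (factorCounts a w n) (maxCount a w n) := by
  have hne : (factorCounts a w n).Nonempty :=
    ⟨_, w.take n, ⟨[], w.drop n, by simp [Stream'.append_take_drop]⟩, by simp, rfl⟩
  have hb : BddAbove (factorCounts a w n) := by
    refine ⟨n, ?_⟩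
    rintro k ⟨u, -, rfl, rfl⟩
    exact List.count_le_length
  exact ⟨Nat.sSup_mem hne hb, fun k hk => le_csSup hb hk⟩

theorem maxCount_succ (a : Bool) (w : InfWord) (n : ℕ) :
    maxCount a w (n + 1) = maxCount a w n ∨ maxCount a w (n + 1) = maxCount a w n + 1 := by
  obtain ⟨⟨u, ⟨p, v, hw⟩, hl, hc⟩, hub⟩ := isGreatest_maxCount a w n
  obtain ⟨⟨u', ⟨p', v', hw'⟩, hl', hc'⟩, hub'⟩ := isGreatest_maxCount a w (n + 1)
  have h1 : maxCount a w n ≤ maxCount a w (n + 1) := by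
    have hmem : (u ++ [v.head]).count a ∈ factorCounts a w (n + 1) := by
      refine ⟨u ++ [v.head], ⟨p, v.tail, ?_⟩, by simp [hl], rfl⟩
      rw [hw, Stream'.append_append_stream]
      congr 2
      change v = Stream'.cons v.head v.tail
      exact (Stream'.eta v).symm
    have h := hub' hmem
    rw [List.count_append] at h
    omega
  have h2 : maxCount a w (n + 1) ≤ maxCount a w n + 1 := by
    cases u' with
    | nil => simp at hl'
    | cons b t =>
      have hmem : t.count a ∈ factorCounts a w n := by
        refine ⟨t, ⟨p' ++ [b], v', ?_⟩, by simpa using hl', rfl⟩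
        rw [hw', Stream'.append_append_stream]
        rfl
      have h := hub hmem
      rw [List.count_cons] at hc'
      split_ifs at hc' <;> omega
  omega

/-- The prefix normal form with respect to `1`: its `n`-th letter, `n ≥ 1`, is
`F^1_w(n) - F^1_w(n-1)`, which is `0` or `1`. -/
noncomputable def PNF₁ (w : InfWord) : InfWord :=
  fun n => decide (maxCount true w (n + 1) - maxCount true w n = 1)

/-- The prefix normal form with respect to `0`: its `n`-th letter, `n ≥ 1`, is the complement of
`F^0_w(n) - F^0_w(n-1)`, which is `0` or `1`. -/
noncomputable def PNF₀ (w : InfWord) : InfWord :=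
  fun n => !decide (maxCount false w (n + 1) - maxCount false w n = 1)

theorem PNF₁_get (w : InfWord) (n : ℕ) :
    (((PNF₁ w).get n).toNat : ℤ) = maxCount true w (n + 1) - maxCount true w n := by
  rcases maxCount_succ true w n with h | h <;> simp [PNF₁, Stream'.get, h]

theorem PNF₀_get (w : InfWord) (n : ℕ) :
    (((PNF₀ w).get n).toNat : ℤ) = 1 - (maxCount false w (n + 1) - maxCount false w n) := by
  rcases maxCount_succ false w n with h | h <;> simp [PNF₀, Stream'.get, h]

/-- The Thue–Morse morphism on letters: `0 ↦ 01`, `1 ↦ 10`. -/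
def thueMorseLetter (a : Bool) : List Bool := [a, !a]

/-- The Thue–Morse morphism on infinite words: the concatenation of the images (all of length `2`)
of the letters. -/
def thueMorse (w : InfWord) : InfWord :=
  fun n => (thueMorseLetter (w.get (n / 2)))[n % 2]'(Nat.mod_lt n two_pos)

theorem thueMorse_cons (a : Bool) (w : InfWord) :
    thueMorse (Stream'.cons a w) = thueMorseLetter a ++ₛ thueMorse w := by
  funext n
  match n with
  | 0 => rfl
  | 1 => rfl
  | n + 2 =>
    have h1 : (n + 2) / 2 = n / 2 + 1 := by omega
    have h2 : (n + 2) % 2 = n % 2 := by omega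
    change (thueMorseLetter ((Stream'.cons a w).get ((n + 2) / 2)))[(n + 2) % 2]'_ = thueMorse w n
    simp only [h1, h2]
    rfl

/- Let `d n` be the number of `1`s minus the number of `0`s among the first `n` letters of `w`, a
walk with steps `±1`. The prefix normal forms are the stated ones iff `F^a_w(n) = ⌊n/2⌋ + 1` for
both letters `a` and all `n ≥ 1`, and for aperiodic `w` this says that any two values of `d` differ
by at most `2`: a bounded walk with `d (i + n) ≤ d i` for all `i` is eventually periodic, so each
length `n` admits a factor with more `a`s than non-`a`s. As `d` alternates in parity, its values lie
in an interval of length `2` iff the middle value is taken at all even or at all odd times, and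
between two consecutive such times `w` reads `01` or `10`. -/

section Stream

variable {α : Type*}

theorem get_cycle {l : List α} (hl : l ≠ []) (n : ℕ) :
    (Stream'.cycle l hl).get n = l[n % l.length]'(Nat.mod_lt n (List.length_pos_iff.2 hl)) := by
  induction n using Nat.strong_induction_on with
  | _ n ih =>
    rw [Stream'.cycle_eq]
    rcases lt_or_ge n l.length with hn | hn
    · simp only [Stream'.get_append_left _ _ _ hn, Nat.mod_eq_of_lt hn]
    · obtain ⟨m, rfl⟩ := Nat.exists_eq_add_of_le hn
      rw [Stream'.get_append_right, ih m (by have := List.length_pos_iff.2 hl; omega)]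
      simp only [Nat.add_mod_left]

theorem eq_cycle_take_of_periodic {s : Stream' α} {k : ℕ} (hs : Function.Periodic s.get k)
    (hk : s.take k ≠ []) : s = Stream'.cycle (s.take k) hk := by
  refine Stream'.ext fun n => ?_
  simp only [get_cycle, Stream'.take_get, Stream'.length_take, hs.map_mod_nat]

end Stream

theorem isUltimatelyPeriodicWord_of_periodic_drop {w : InfWord} {N k : ℕ} (hk : 0 < k)
    (hw : Function.Periodic (w.drop N).get k) : IsUltimatelyPeriodicWord w := by
  have hne : (w.drop N).take k ≠ [] := by
    rw [← List.length_pos_iff, Stream'.length_take]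
    exact hk
  refine ⟨w.take N, (w.drop N).take k, hne, ?_⟩
  rw [← eq_cycle_take_of_periodic hw hne, Stream'.append_take_drop]

theorem bddBelow_range_of_le_add {d : ℕ → ℤ} {c : ℤ} (h : ∀ m n, d n ≤ d m + c) :
    BddBelow (Set.range d) := by
  refine ⟨d 0 - c, ?_⟩
  rintro _ ⟨m, rfl⟩
  linarith [h m 0]

/- The window sums `d i + ⋯ + d (i + n - 1)` are antitone in `i`; once they have reached their
minimum they are constant, so that `d (i + n) = d i`. -/
theorem exists_forall_ge_add_eq_self_of_add_le_self {d : ℕ → ℤ} {n : ℕ}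
    (hd : BddBelow (Set.range d)) (hle : ∀ i, d (i + n) ≤ d i) : ∃ N, ∀ i ≥ N, d (i + n) = d i := by
  obtain ⟨b, hb⟩ := hd
  set S : ℕ → ℤ := fun i => ∑ j ∈ Finset.range n, d (i + j) with hS
  have hsucc (i : ℕ) : S (i + 1) + d i = S i + d (i + n) := by
    simp only [hS, ← Finset.sum_range_succ fun j => d (i + j), Finset.sum_range_succ', add_zero,
      add_assoc, add_comm 1]
  have hanti : Antitone S := antitone_nat_of_succ_le fun i => by linarith [hsucc i, hle i]
  have hbdd : BddBelow (Set.range S) := by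
    refine ⟨n * b, ?_⟩
    rintro _ ⟨i, rfl⟩
    simpa using Finset.card_nsmul_le_sum (Finset.range n) (fun j => d (i + j)) b
      fun j _ => hb (Set.mem_range_self _)
  obtain ⟨N, hN⟩ := Int.csInf_mem (Set.range_nonempty S) hbdd
  have hconst (i : ℕ) (hi : N ≤ i) : S i = S N :=
    (hanti hi).antisymm (hN ▸ csInf_le hbdd (Set.mem_range_self i))
  refine ⟨N, fun i hi => ?_⟩
  have := hsucc i
  rw [hconst i hi, hconst (i + 1) (by omega)] at this
  exact (add_left_cancel this).symm

theorem forall_le_add_two_iff_of_modEq {d : ℕ → ℤ} (hpar : ∀ n, d n ≡ n [ZMOD 2])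
    (hstep : ∀ n, |d (n + 1) - d n| ≤ 1) :
    (∀ m n, d n ≤ d m + 2) ↔ ∃ p < 2, ∀ i, d (2 * i + p) = d p := by
  constructor
  · intro h
    have hb : BddBelow (Set.range d) := bddBelow_range_of_le_add h
    obtain ⟨x, hx⟩ := Int.csInf_mem (Set.range_nonempty d) hb
    have hmid (n : ℕ) (hn : n % 2 ≠ x % 2) : d n = d x + 1 := by
      have hmin : d x ≤ d n := hx ▸ csInf_le hb (Set.mem_range_self n)
      have hmax := h x n
      have hparn : d n % 2 = n % 2 := hpar n
      have hparx : d x % 2 = x % 2 := hpar x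
      omega
    refine ⟨(x + 1) % 2, Nat.mod_lt _ two_pos, fun i => ?_⟩
    rw [hmid (2 * i + (x + 1) % 2) (by omega), hmid ((x + 1) % 2) (by omega)]
  · rintro ⟨p, hp, h⟩
    have hmid (n : ℕ) : |d n - d p| ≤ 1 := by
      obtain ⟨k, hk | hk⟩ := Nat.even_or_odd' (n + p)
      · rw [show n = 2 * (k - p) + p by omega, h]
        simp
      · have hn := hstep n
        rwa [show n + 1 = 2 * (k + 1 - p) + p by omega, h, abs_sub_comm] at hn
    intro m n
    have hm := abs_le.1 (hmid m)
    have hn := abs_le.1 (hmid n)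
    omega

/-- The number of letters `a` minus the number of letters `!a` among the first `n` letters of `w`.
As a function of `n` it is a walk with steps `±1`, whose increments over `n` steps have maximum
`2 * maxCount a w n - n`. -/
def excess (a : Bool) (w : InfWord) (n : ℕ) : ℤ :=
  2 * (w.take n).count a - n

theorem excess_succ (a : Bool) (w : InfWord) (n : ℕ) :
    excess a w (n + 1) = excess a w n + if w.get n = a then 1 else -1 := by
  simp only [excess, Stream'.take_succ', List.count_append, List.count_singleton, beq_iff_eq]
  split_ifs <;> push_cast <;> ring

theorem abs_excess_succ_sub_le (a : Bool) (w : InfWord) (n : ℕ) :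
    |excess a w (n + 1) - excess a w n| ≤ 1 := by
  rw [excess_succ]
  split_ifs <;> simp

theorem excess_not (a : Bool) (w : InfWord) (n : ℕ) : excess (!a) w n = -excess a w n := by
  have h := List.count_not_add_count (w.take n) a
  rw [Stream'.length_take] at h
  unfold excess
  omega

theorem excess_modEq (a : Bool) (w : InfWord) (n : ℕ) : excess a w n ≡ n [ZMOD 2] := by
  unfold excess Int.ModEq
  omega

theorem excess_add (a : Bool) (w : InfWord) (i n : ℕ) :
    excess a w (i + n) = excess a w i + (2 * ((w.drop i).take n).count a - n) := by
  simp only [excess, Stream'.take_add, List.count_append]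
  push_cast
  ring

theorem get_eq_get_of_excess {a : Bool} {w : InfWord} {i j : ℕ} (h : excess a w i = excess a w j)
    (h' : excess a w (i + 1) = excess a w (j + 1)) : w.get i = w.get j := by
  rw [excess_succ, excess_succ, h] at h'
  revert h'
  cases w.get i <;> cases w.get j <;> cases a <;> simp

theorem factorCounts_eq_range (a : Bool) (w : InfWord) (n : ℕ) :
    factorCounts a w n = Set.range fun i => ((w.drop i).take n).count a := by
  ext k
  constructor
  · rintro ⟨u, ⟨p, v, rfl⟩, rfl, rfl⟩
    refine ⟨p.length, ?_⟩
    simp only [Stream'.drop_append_stream, Stream'.take_append_of_le_length _ _ _ le_rfl,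
      List.take_length]
  · rintro ⟨i, rfl⟩
    refine ⟨(w.drop i).take n, ⟨w.take i, (w.drop i).drop n, ?_⟩, Stream'.length_take n _, rfl⟩
    rw [Stream'.append_take_drop, Stream'.append_take_drop]

theorem excess_add_le (a : Bool) (w : InfWord) (i n : ℕ) :
    excess a w (i + n) ≤ excess a w i + (2 * maxCount a w n - n) := by
  have h := (isGreatest_maxCount a w n).2 (factorCounts_eq_range a w n ▸ Set.mem_range_self i)
  rw [excess_add]
  gcongr

theorem exists_excess_add_eq (a : Bool) (w : InfWord) (n : ℕ) :
    ∃ i, excess a w (i + n) = excess a w i + (2 * maxCount a w n - n) := by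
  have h := (isGreatest_maxCount a w n).1
  rw [factorCounts_eq_range] at h
  obtain ⟨i, hi⟩ := h
  exact ⟨i, by rw [excess_add, ← hi]⟩

theorem maxCount_zero (a : Bool) (w : InfWord) : maxCount a w 0 = 0 := by
  obtain ⟨i, hi⟩ := exists_excess_add_eq a w 0
  simpa using hi

theorem exists_excess_lt_excess_add {a : Bool} {w : InfWord} (hw : ¬ IsUltimatelyPeriodicWord w)
    (hb : BddBelow (Set.range (excess a w))) {n : ℕ} (hn : 0 < n) :
    ∃ i, excess a w i < excess a w (i + n) := by
  by_contra! hle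
  obtain ⟨N, hN⟩ := exists_forall_ge_add_eq_self_of_add_le_self hb hle
  refine hw (isUltimatelyPeriodicWord_of_periodic_drop (N := N) hn fun i => ?_)
  rw [Stream'.get_drop, Stream'.get_drop, ← add_assoc]
  refine get_eq_get_of_excess (hN (N + i) (by omega)) ?_
  rw [add_right_comm]
  exact hN (N + i + 1) (by omega)

theorem excess_le_add_two_of_maxCount_eq {w : InfWord}
    (h : ∀ a n, 0 < n → maxCount a w n = n / 2 + 1) (a : Bool) (m n : ℕ) :
    excess a w n ≤ excess a w m + 2 := by
  have hle (b : Bool) (i k : ℕ) : excess b w (i + k) ≤ excess b w i + 2 := by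
    rcases k.eq_zero_or_pos with rfl | hk
    · simp
    · have := excess_add_le b w i k
      rw [h b k hk] at this
      omega
  rcases le_total m n with hmn | hnm
  · obtain ⟨k, rfl⟩ := Nat.exists_eq_add_of_le hmn
    exact hle a m k
  · obtain ⟨k, rfl⟩ := Nat.exists_eq_add_of_le hnm
    have := hle (!a) n k
    rw [excess_not, excess_not] at this
    linarith

theorem maxCount_eq_of_excess_le_add_two {a : Bool} {w : InfWord}
    (hw : ¬ IsUltimatelyPeriodicWord w) (h : ∀ m n, excess a w n ≤ excess a w m + 2) {n : ℕ}
    (hn : 0 < n) : maxCount a w n = n / 2 + 1 := by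
  have hb : BddBelow (Set.range (excess a w)) := bddBelow_range_of_le_add h
  obtain ⟨i, hi⟩ := exists_excess_add_eq a w n
  obtain ⟨j, hj⟩ := exists_excess_lt_excess_add hw hb hn
  have hupper := h i (i + n)
  have hlower := excess_add_le a w j n
  omega

theorem forall_maxCount_eq_half_add_one_iff {w : InfWord}
    (hw : ¬ IsUltimatelyPeriodicWord w) (a : Bool) :
    (∀ b n, 0 < n → maxCount b w n = n / 2 + 1) ↔ ∀ m n, excess a w n ≤ excess a w m + 2 := by
  refine ⟨fun h => excess_le_add_two_of_maxCount_eq h a, fun h b n hn => ?_⟩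
  refine maxCount_eq_of_excess_le_add_two hw (fun i j => ?_) hn
  rcases Bool.eq_or_eq_not b a with rfl | rfl
  · exact h i j
  · rw [excess_not, excess_not]
    linarith [h j i]

theorem thueMorse_eq_interleave (w : InfWord) : thueMorse w = w ⋈ w.map not := by
  refine Stream'.ext fun n => ?_
  obtain ⟨i, rfl | rfl⟩ := Nat.even_or_odd' n
  · rw [Stream'.get_interleave_left]
    simp [thueMorse, thueMorseLetter, Stream'.get]
  · have hi : (2 * i + 1) / 2 = i := by omega
    rw [Stream'.get_interleave_right, Stream'.get_map]
    simp [thueMorse, thueMorseLetter, Stream'.get, hi]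

theorem mem_range_thueMorse_iff {w : InfWord} :
    w ∈ Set.range thueMorse ↔ ∀ i, w.get (2 * i + 1) = !w.get (2 * i) := by
  simp only [thueMorse_eq_interleave, Set.mem_range]
  constructor
  · rintro ⟨w', rfl⟩ i
    rw [Stream'.get_interleave_left, Stream'.get_interleave_right, Stream'.get_map]
  · intro h
    refine ⟨w.even, ?_⟩
    rw [show w.even.map not = w.odd from Stream'.ext fun i => by
      rw [Stream'.get_map, Stream'.get_even, Stream'.get_odd, h], Stream'.interleave_even_odd]

theorem drop_mem_range_thueMorse_iff {w : InfWord} {p : ℕ} (a : Bool) :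
    w.drop p ∈ Set.range thueMorse ↔ ∀ i, excess a w (2 * i + p) = excess a w p := by
  have hblock (i : ℕ) : w.get (2 * i + p + 1) = !w.get (2 * i + p) ↔
      excess a w (2 * (i + 1) + p) = excess a w (2 * i + p) := by
    rw [show 2 * (i + 1) + p = 2 * i + p + 1 + 1 by ring, excess_succ, excess_succ]
    cases w.get (2 * i + p) <;> cases w.get (2 * i + p + 1) <;> grind
  have hdrop : w.drop p ∈ Set.range thueMorse ↔
      ∀ i, w.get (2 * i + p + 1) = !w.get (2 * i + p) := by
    rw [mem_range_thueMorse_iff]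
    refine forall_congr' fun i => ?_
    rw [Stream'.get_drop, Stream'.get_drop, ← add_assoc, add_comm p]
  simp only [hdrop, hblock]
  refine ⟨fun h i => ?_, fun h i => (h (i + 1)).trans (h i).symm⟩
  induction i with
  | zero => simp
  | succ i ih => exact (h i).trans ih

theorem exists_eq_thueMorse_iff_drop_mem_range {w : InfWord} :
    (∃ w' : InfWord,
      w = thueMorse w' ∨ w = [false] ++ₛ thueMorse w' ∨ w = [true] ++ₛ thueMorse w') ↔
    ∃ p < 2, w.drop p ∈ Set.range thueMorse := by
  constructor
  · rintro ⟨w', rfl | rfl | rfl⟩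
    · exact ⟨0, two_pos, w', rfl⟩
    all_goals exact ⟨1, one_lt_two, w', rfl⟩
  · rintro ⟨p, hp, w', hw'⟩
    refine ⟨w', ?_⟩
    interval_cases p
    · exact Or.inl hw'.symm
    · have hcons : w = [w.head] ++ₛ thueMorse w' := by
        rw [hw']
        exact (Stream'.append_stream_head_tail w).symm
      cases h : w.head <;> rw [h] at hcons
      exacts [Or.inr (Or.inl hcons), Or.inr (Or.inr hcons)]

theorem exists_eq_thueMorse_iff_excess_le_add_two {w : InfWord} (a : Bool) :
    (∃ w' : InfWord,
      w = thueMorse w' ∨ w = [false] ++ₛ thueMorse w' ∨ w = [true] ++ₛ thueMorse w') ↔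
    ∀ m n, excess a w n ≤ excess a w m + 2 := by
  rw [exists_eq_thueMorse_iff_drop_mem_range,
    forall_le_add_two_iff_of_modEq (excess_modEq a w) (abs_excess_succ_sub_le a w)]
  simp only [drop_mem_range_thueMorse_iff a]

theorem eq_cons_cycle_iff {s : InfWord} {a : Bool} :
    s = [a] ++ₛ Stream'.cycle [a, !a] (List.cons_ne_nil _ _) ↔
      ∀ n, s.get n = a ↔ n = 0 ∨ n % 2 = 1 := by
  have hcycle (n : ℕ) : (Stream'.cycle [a, !a] (List.cons_ne_nil _ _)).get n = a ↔ n % 2 = 0 := by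
    rw [get_cycle]
    obtain h | h := Nat.mod_two_eq_zero_or_one n <;> simp [h]
  have hword (n : ℕ) : ([a] ++ₛ Stream'.cycle [a, !a] (List.cons_ne_nil _ _)).get n = a ↔
      n = 0 ∨ n % 2 = 1 := by
    cases n with
    | zero => simp
    | succ n =>
      rw [Stream'.append_eq_cons, Stream'.get_succ_cons, hcycle]
      omega
  simp only [← hword]
  refine ⟨fun h n => by rw [h], fun h => Stream'.ext fun n => ?_⟩
  by_cases hn : s.get n = a
  · rw [hn, (h n).1 hn]
  · rw [Bool.eq_not_of_ne hn, Bool.eq_not_of_ne (mt (h n).2 hn)]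

theorem forall_maxCount_sub_eq_one_iff {a : Bool} {w : InfWord} :
    (∀ n, maxCount a w (n + 1) - maxCount a w n = 1 ↔ n = 0 ∨ n % 2 = 1) ↔
      ∀ n, 0 < n → maxCount a w n = n / 2 + 1 := by
  constructor
  · intro h n hn
    induction n, hn using Nat.le_induction with
    | base =>
      have := (h 0).2 (Or.inl rfl)
      rwa [maxCount_zero] at this
    | succ n hn ih =>
      have := h n
      rcases maxCount_succ a w n with h' | h' <;> omega
  · intro h n
    rw [h (n + 1) n.succ_pos]
    rcases n.eq_zero_or_pos with rfl | hn
    · simp [maxCount_zero]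
    · rw [h n hn]
      omega

theorem PNF₁_eq_iff {w : InfWord} :
    PNF₁ w = [true] ++ₛ Stream'.cycle [true, false] (List.cons_ne_nil _ _) ↔
      ∀ n, 0 < n → maxCount true w n = n / 2 + 1 := by
  refine (eq_cons_cycle_iff (a := true)).trans ?_
  simp only [PNF₁, Stream'.get, decide_eq_true_iff, forall_maxCount_sub_eq_one_iff]

theorem PNF₀_eq_iff {w : InfWord} :
    PNF₀ w = [false] ++ₛ Stream'.cycle [false, true] (List.cons_ne_nil _ _) ↔
      ∀ n, 0 < n → maxCount false w n = n / 2 + 1 := by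
  refine (eq_cons_cycle_iff (a := false)).trans ?_
  simp only [PNF₀, Stream'.get, Bool.not_eq_false', decide_eq_true_iff,
    forall_maxCount_sub_eq_one_iff]

theorem corollary3 (w : InfWord) (hw : IsAperiodicWord w) :
    (PNF₁ w = [true] ++ₛ Stream'.cycle [true, false] (List.cons_ne_nil _ _) ∧
      PNF₀ w = [false] ++ₛ Stream'.cycle [false, true] (List.cons_ne_nil _ _)) ↔
    ∃ w' : InfWord,
      w = thueMorse w' ∨ w = [false] ++ₛ thueMorse w' ∨ w = [true] ++ₛ thueMorse w' := by
  rw [PNF₁_eq_iff, PNF₀_eq_iff, exists_eq_thueMorse_iff_excess_le_add_two true,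
    ← forall_maxCount_eq_half_add_one_iff hw.2, Bool.forall_bool, and_comm]
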